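/- \textbf{Definitions.} Let $I=[0,1]$; path spaces $X^I$ carry the compact-open topology. Let $f:S\to O$ be continuous and $\Delta f=\{(s,\alpha)\in S\times O^I : f(s)=\alpha(0)\}$. A \emph{lifting function} for $f$ is a continuous map $L:\Delta f\to S^I$ with $L(s,\alpha)(0)=s$ and $f\circ L(s,\alpha)=\alpha$; $f$ is a (Hurewicz) fibration exactly if it has one. For $r_o\in O$ let $F_{r_o}=f^{-1}(r_o)$ and let $\Omega(O,r_o)$ be the space of loops in $O$ at $r_o$. For $s\in F_{r_o}$ the \emph{$Lf$-restriction} is the map $f^{s}:\Omega(O,r_o)\to F_{r_o}$, $f^{s}(\alpha)=L(s,\alpha)(1)$. For $F\subseteq S$ and $s\in F$ put $\Gamma(S,F,s)=\{\alpha\in S^I:\alpha(0)=s,\ \alpha(1)\in F\}$ and $\Psi_{s}:\Gamma(S,F,s)\to F$, $\Psi_s(\alpha)=\alpha(1)$. \textbf{Theorem.} Let $f_1:S_1\to O$ and $f_2:S_2\to O$ be fibrations with lifting functions $L_1$ and $L_2$, let $r_o\in O$, $F^i_{r_o}=f_i^{-1}(r_o)$ and $s_o\in F^1_{r_o}$.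 Let $g:F^1_{r_o}\to F^2_{r_o}$ be a homotopy equivalence with homotopy inverse $\bar g$, and suppose that the $Lf$-restrictions $f_1^{s_o}$ and $f_2^{g(s_o)}$ are conjugate by $g$, that is, $f_1^{s_o}$ is homotopic to $\bar g\circ f_2^{g(s_o)}$. Then there are continuous maps \[h:\Gamma(S_1,F^1_{r_o},s_o)\to\Gamma(S_2,F^2_{r_o},g(s_o)),\qquad k:\Gamma(S_2,F^2_{r_o},g(s_o))\to\Gamma(S_1,F^1_{r_o},\bar g(g(s_o)))\] which are fiber maps over $g$ and $\bar g$ respectively, that is, $\Psi_{g(s_o)}\circ h=g\circ\Psi_{s_o}$ and $\Psi_{\bar g(g(s_o))}\circ k=\bar g\circ\Psi_{g(s_o)}$. Moreover, the groups $\pi_n(S_1,s_o)$ and $\pi_n(S_2,g(s_o))$ are isomorphic for every integer $n>1$. -/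

import Mathlib

open scoped unitInterval Topology Topology.Homotopy ContinuousMap

noncomputable section

namespace LfFibration

/-- The space `Δf = {(s, α) ∈ S × O^I : f(s) = α(0)}`; path spaces `C(I, X)` carry the
compact-open topology. -/
abbrev Delta {S O : Type*} [TopologicalSpace S] [TopologicalSpace O] (f : C(S, O)) : Type _ :=
  {p : S × C(I, O) // f p.1 = p.2 0}

/-- A lifting function for `f`: a continuous map `L : Δf → S^I` with `L(s, α)(0) = s` and
`f ∘ L(s, α) = α`. The maps that have one are exactly the Hurewicz fibrations. -/
structure LiftingFunction {S O : Type*} [TopologicalSpace S] [TopologicalSpace O]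
    (f : C(S, O)) where
  toMap : C(Delta f, C(I, S))
  start : ∀ p : Delta f, toMap p 0 = p.1.1
  lifts : ∀ p : Delta f, f.comp (toMap p) = p.1.2

/-- The fiber space `F_{r} = f⁻¹(r)`, with the subspace topology when used as a space. -/
abbrev Fiber {S O : Type*} [TopologicalSpace S] [TopologicalSpace O] (f : C(S, O)) (r : O) :
    Set S :=
  f ⁻¹' {r}

/-- The map `Ω(O, r) × F_r → Δf` that sends `(α, s)` to `(s, α)`. -/
def toDelta {S O : Type*} [TopologicalSpace S] [TopologicalSpace O] (f : C(S, O)) (r : O) :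
    C(Ω O r × Fiber f r, Delta f) where
  toFun p := ⟨(p.2.1, p.1.toContinuousMap), by
    have h : f p.2.1 = r := p.2.2
    simpa using h⟩
  continuous_toFun := by
    refine Continuous.subtype_mk (Continuous.prodMk (by fun_prop) ?_) _
    exact continuous_induced_dom.comp continuous_fst

/-- The `Lf`-function `Θ_L : Ω(O, r) × F_r → F_r`, `Θ_L(α, s) = L(s, α)(1)`. -/
def LiftingFunction.lfFunction {S O : Type*} [TopologicalSpace S] [TopologicalSpace O]
    {f : C(S, O)} (L : LiftingFunction f) (r : O) :
    C(Ω O r × Fiber f r, Fiber f r) where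
  toFun p := ⟨L.toMap (toDelta f r p) 1, by
    have h := DFunLike.congr_fun (L.lifts (toDelta f r p)) 1
    have h' : p.1 1 = r := p.1.target
    exact h.trans h'⟩
  continuous_toFun := by
    refine Continuous.subtype_mk ?_ _
    exact (continuous_eval_const (1 : I)).comp
      (L.toMap.continuous.comp (toDelta f r).continuous)

/-- The `Lf`-restriction `f^s : Ω(O, r) → F_r`, `f^s(α) = Θ_L(α, s)`, for `s ∈ F_r`. -/
def LiftingFunction.lfRestriction {S O : Type*} [TopologicalSpace S] [TopologicalSpace O]
    {f : C(S, O)} (L : LiftingFunction f) (r : O) (s : Fiber f r) :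
    C(Ω O r, Fiber f r) where
  toFun α := L.lfFunction r (α, s)
  continuous_toFun := (L.lfFunction r).continuous.comp (by fun_prop)

/-- The `Lf`-restrictions `f₁^s` and `f₂^{g(s)}` are conjugate by the homotopy equivalence `g`
(which comes with a homotopy inverse `g.symm`): `f₁^s ≃ g.symm ∘ f₂^{g(s)}`. -/
def ConjugateLfRestrictions {S₁ S₂ O : Type*} [TopologicalSpace S₁] [TopologicalSpace S₂]
    [TopologicalSpace O] {f₁ : C(S₁, O)} {f₂ : C(S₂, O)}
    (L₁ : LiftingFunction f₁) (L₂ : LiftingFunction f₂) (r : O)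
    (g : Fiber f₁ r ≃ₕ Fiber f₂ r) (s : Fiber f₁ r) : Prop :=
  (L₁.lfRestriction r s).Homotopic (g.symm.toFun.comp (L₂.lfRestriction r (g s)))

/-- `Γ(S, F, s) = {α ∈ S^I : α(0) = s, α(1) ∈ F}`, for `F ⊆ S` and `s ∈ F`. -/
abbrev Gam {S : Type*} [TopologicalSpace S] (F : Set S) (s : F) : Type _ :=
  {α : C(I, S) // α 0 = s ∧ α 1 ∈ F}

/-- The end point map `Ψ_s : Γ(S, F, s) → F`, `Ψ_s(α) = α(1)`. -/
def Psi {S : Type*} [TopologicalSpace S] (F : Set S) (s : F) : C(Gam F s, F) where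
  toFun α := ⟨α.1 1, α.2.2⟩
  continuous_toFun :=
    ((continuous_eval_const (1 : I)).comp continuous_subtype_val).subtype_mk _

/-- `h : E → E'` is a fiber map over `φ : B → B'`, from `p : E → B` to `q : E' → B'`. -/
def IsFiberMapOver {E E' B B' : Type*} [TopologicalSpace E] [TopologicalSpace E']
    [TopologicalSpace B] [TopologicalSpace B'] (p : C(E, B)) (q : C(E', B'))
    (φ : C(B, B')) (h : C(E, E')) : Prop :=
  q.comp h = φ.comp p

end LfFibration

end

/-! Projecting a path of Γ(S, F, s) to O is a homotopy equivalence onto Ω(O, r), with loop lifting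
as inverse (`LiftingFunction.liftLoop_comp_projLoop`), and it turns Ψ_s into the Lf-restriction up
to homotopy. Conjugacy thus yields a homotopy from f₂^{g(s)} ∘ (projection) to g ∘ Ψ_s. Lifting the
projected loop to S₂ and appending the track of this homotopy, which stays in the fiber, corrects
the end point: the resulting h covers g strictly (`LiftingFunction.extend`). The map k arises in the
same way, preceded by a path from ḡ(g(s)) to s.

For the homotopy groups, h respects the projections to Ω(O, r) up to homotopy, so it is a homotopy
equivalence (`isHomotopyEquiv_of_projLoop`). Since Ψ is a fibration whose fiber over s is the loop
space of S at s, and h covers the homotopy equivalence g, it should induce an equivalence of loop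
spaces. Only path components are needed: the spaces of cubes with constant boundary value
(`FreeSphere`) again form fibrations, and comparing fundamental groupoids gives a bijection on
components of fibers (`joinedIn_fiber_of_map`, `exists_joinedIn_fiber_of_map`). In a loop space free
and based homotopy of spheres agree (`homotopic_of_joined`), which gives isomorphisms of the groups
π_{m+1} of the loop spaces, that is, of π_{m+2} of S₁ and S₂. -/

namespace LfFibration

/-! ### Homotopy equivalences and the fundamental groupoid. -/

section Groupoid

variable {X Y Z : Type*} [TopologicalSpace X] [TopologicalSpace Y] [TopologicalSpace Z]

open Path

theorem quotient_map_id {x y : X} (p : Homotopic.Quotient x y) : p.map (ContinuousMap.id X) = p := by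
  induction p with | mk p => rfl

theorem quotient_map_trans {x y z : X} (f : C(X, Y)) (p : Homotopic.Quotient x y) (q : Homotopic.Quotient y z) :
    (p.trans q).map f = (p.map f).trans (q.map f) := by
  induction p with | mk p =>
  induction q with | mk q =>
  rw [← Homotopic.Quotient.mk_trans, ← Homotopic.Quotient.mk_map, Path.map_trans]; rfl

theorem quotient_map_symm {x y : X} (f : C(X, Y)) (p : Homotopic.Quotient x y) :
    p.symm.map f = (p.map f).symm := by
  induction p with | mk p => rfl

theorem quotient_map_trans_evalAt {f g : C(X, Y)} (F : f.Homotopy g) {x y : X}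
    (p : Homotopic.Quotient x y) :
    (p.map f).trans (Homotopic.Quotient.mk (F.evalAt y)) =
      (Homotopic.Quotient.mk (F.evalAt x)).trans (p.map g) := by
  induction p with | mk p =>
  exact Homotopic.Quotient.eq.2 (Path.Homotopic.map_trans_evalAt F p)

theorem quotient_trans_right_cancel {x y z : X} {p q : Homotopic.Quotient x y} {r : Homotopic.Quotient y z}
    (h : p.trans r = q.trans r) : p = q := by
  have := congrArg (fun u => u.trans r.symm) h
  simpa using this

theorem quotient_trans_left_cancel {x y z : X} {p q : Homotopic.Quotient y z} {r : Homotopic.Quotient x y}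
    (h : r.trans p = r.trans q) : p = q := by
  have := congrArg (fun u => r.symm.trans u) h
  simpa [← Homotopic.Quotient.trans_assoc] using this

theorem quotient_trans_symm_trans {x y z : X} (r : Homotopic.Quotient x y)
    (p : Homotopic.Quotient x z) : r.trans (r.symm.trans p) = p := by
  simp [← Homotopic.Quotient.trans_assoc]

/-- A map which has a homotopy inverse. -/
def IsHomotopyEquiv (h : C(X, Y)) : Prop :=
  ∃ k : C(Y, X), (k.comp h).Homotopic (.id X) ∧ (h.comp k).Homotopic (.id Y)

/-- By naturality of the homotopy tracks, the image of a class under k ∘ h is its conjugate by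
tracks, and conjugation is injective. -/
theorem quotient_map_injective_of_homotopic_id {h : C(X, Y)} {k : C(Y, X)}
    (H : (k.comp h).Homotopic (.id X)) {x y : X} {p q : Homotopic.Quotient x y} (e : p.map h = q.map h) :
    p = q := by
  obtain ⟨F⟩ := H
  have hp := quotient_map_trans_evalAt F p
  have hq := quotient_map_trans_evalAt F q
  rw [Homotopic.Quotient.map_comp, quotient_map_id] at hp hq
  rw [e, hq] at hp
  exact (quotient_trans_left_cancel hp).symm

theorem IsHomotopyEquiv.quotient_map_injective {h : C(X, Y)} (hh : IsHomotopyEquiv h) {x y : X}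
    {p q : Homotopic.Quotient x y} (e : p.map h = q.map h) : p = q := by
  obtain ⟨k, hk, -⟩ := hh
  exact quotient_map_injective_of_homotopic_id hk e

theorem IsHomotopyEquiv.quotient_map_surjective {h : C(X, Y)} (hh : IsHomotopyEquiv h) {x y : X}
    (r : Homotopic.Quotient (h x) (h y)) : ∃ p : Homotopic.Quotient x y, p.map h = r := by
  obtain ⟨k, hk, hk'⟩ := hh
  obtain ⟨F⟩ := id hk
  -- The candidate is the image of r under k, conjugated back by the tracks of k ∘ h ≃ id. Its image
  -- under h is identified after applying k, which is faithful because h ∘ k ≃ id.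
  let p : Homotopic.Quotient x y :=
    (Homotopic.Quotient.mk (F.evalAt x)).symm.trans ((r.map k).trans (Homotopic.Quotient.mk (F.evalAt y)))
  refine ⟨p, quotient_map_injective_of_homotopic_id hk' (quotient_trans_right_cancel
    (r := Homotopic.Quotient.mk (F.evalAt y)) ?_)⟩
  have := quotient_map_trans_evalAt F p
  rw [Homotopic.Quotient.map_comp, quotient_map_id] at this
  refine this.trans ?_
  exact quotient_trans_symm_trans _ _

theorem IsHomotopyEquiv.exists_joined {h : C(X, Y)} (hh : IsHomotopyEquiv h) (y : Y) :
    ∃ x, Joined (h x) y := by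
  obtain ⟨k, -, ⟨F⟩⟩ := hh
  exact ⟨k y, ⟨F.evalAt y⟩⟩

end Groupoid

/-! ### Path components of fibers of fibrations. -/

section Fiber

variable {E B E' B' : Type*} [TopologicalSpace E] [TopologicalSpace B] [TopologicalSpace E']
  [TopologicalSpace B']

open Path

/-- The homotopy lifting property. -/
theorem LiftingFunction.exists_lift {p : C(E, B)} (L : LiftingFunction p) {Z : Type*}
    [TopologicalSpace Z] (a : C(Z, E)) (K : C(Z × I, B)) (h : ∀ z, p (a z) = K (z, 0)) :
    ∃ K' : C(Z × I, E), (∀ z, K' (z, 0) = a z) ∧ ∀ z t, p (K' (z, t)) = K (z, t) := by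
  let c : C(Z, Delta p) := ⟨fun z => ⟨(a z, K.curry z), h z⟩, by fun_prop⟩
  refine ⟨(L.toMap.comp c).uncurry, fun z => L.start (c z), fun z t => ?_⟩
  exact DFunLike.congr_fun (L.lifts (c z)) t

theorem LiftingFunction.exists_path_lift {p : C(E, B)} (L : LiftingFunction p) {e : E} {b : B}
    (δ : Path (p e) b) : ∃ (e' : E) (δ' : Path e e'), ∀ t, p (δ' t) = δ t := by
  obtain ⟨K, h₀, h₁⟩ := L.exists_lift (Z := Unit) (.const _ e)
    (δ.toContinuousMap.comp ContinuousMap.snd) (by simp)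
  exact ⟨K ((), 1), ⟨⟨fun t => K ((), t), by fun_prop⟩, h₀ (), rfl⟩, fun t => h₁ () t⟩

/-- Two points of a fiber are joined in it when they are joined by a path whose
projection is homotopic to a constant path. -/
theorem LiftingFunction.joinedIn_fiber {p : C(E, B)} (L : LiftingFunction p) {e₀ e₁ : E} {b : B}
    (h₀ : p e₀ = b) (h₁ : p e₁ = b) (d : Homotopic.Quotient e₀ e₁)
    (hd : d.map p = (Homotopic.Quotient.refl b).cast h₀ h₁) : JoinedIn (p ⁻¹' {b}) e₀ e₁ := by
  induction d with | mk D =>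
  rw [← Homotopic.Quotient.mk_map, ← Homotopic.Quotient.mk_refl, ← Homotopic.Quotient.mk_cast, Homotopic.Quotient.eq] at hd
  obtain ⟨K⟩ := hd
  -- The null homotopy is lifted starting from D; the other three sides of the lifted square lie in
  -- the fiber and join the end points of D.
  obtain ⟨K', hK₀, hK⟩ := L.exists_lift (Z := I) D.toContinuousMap
    (K.toContinuousMap.comp ContinuousMap.prodSwap) (fun z => by simp)
  replace hK : ∀ s t, p (K' (s, t)) = K (t, s) := hK
  have j₀ : JoinedIn (p ⁻¹' {b}) e₀ (K' (0, 1)) :=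
    ⟨⟨⟨fun t => K' (0, t), by fun_prop⟩, by simp [hK₀], rfl⟩, fun t => by simp [hK, h₀]⟩
  have j₁ : JoinedIn (p ⁻¹' {b}) (K' (0, 1)) (K' (1, 1)) :=
    ⟨⟨⟨fun t => K' (t, 1), by fun_prop⟩, rfl, rfl⟩, fun t => by simp [hK]⟩
  have j₂ : JoinedIn (p ⁻¹' {b}) e₁ (K' (1, 1)) :=
    ⟨⟨⟨fun t => K' (1, t), by fun_prop⟩, by simp [hK₀], rfl⟩, fun t => by simp [hK, h₁]⟩
  exact (j₀.trans j₁).trans j₂.symm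

theorem quotient_map_map_of_comm {p : C(E, B)} {q : C(E', B')} {h : C(E, E')} {g : C(B, B')}
    (hq : ∀ e, q (h e) = g (p e)) {x y : E} (d : Homotopic.Quotient x y) :
    (d.map p).map g = ((d.map h).map q).cast (hq x).symm (hq y).symm := by
  induction d with | mk D =>
  simp only [← Homotopic.Quotient.mk_map, ← Homotopic.Quotient.mk_cast]
  congr 1
  ext t
  exact (hq (D t)).symm

theorem quotient_map_eq_refl {p : C(E, B)} {b : B} {x y : E} (hx : p x = b) (hy : p y = b)
    (D : Path x y) (hD : ∀ t, p (D t) = b) :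
    (Homotopic.Quotient.mk D).map p = (Homotopic.Quotient.refl b).cast hx hy := by
  rw [← Homotopic.Quotient.mk_map, ← Homotopic.Quotient.mk_refl, ← Homotopic.Quotient.mk_cast]
  congr 1
  ext t
  exact hD t

/-- Fullness of h on fundamental groupoids pulls the path back to a class from e₀ to e₁;
faithfulness of g shows that its projection is trivial. -/
theorem joinedIn_fiber_of_map {p : C(E, B)} {q : C(E', B')} (L : LiftingFunction p)
    {h : C(E, E')} {g : C(B, B')} (hq : ∀ e, q (h e) = g (p e)) (hh : IsHomotopyEquiv h)
    (hg : IsHomotopyEquiv g) {b : B} {e₀ e₁ : E} (h₀ : p e₀ = b) (h₁ : p e₁ = b)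
    (hj : JoinedIn (q ⁻¹' {g b}) (h e₀) (h e₁)) : JoinedIn (p ⁻¹' {b}) e₀ e₁ := by
  obtain ⟨D', hD'⟩ := hj
  obtain ⟨d, hd⟩ := hh.quotient_map_surjective (Homotopic.Quotient.mk D')
  refine L.joinedIn_fiber h₀ h₁ d (hg.quotient_map_injective ?_)
  rw [quotient_map_map_of_comm hq, hd, quotient_map_eq_refl (b := g b) _ _ D' hD',
    Homotopic.Quotient.cast_cast, Homotopic.Quotient.map_cast]
  · rfl
  · rw [hq, h₀]
  · rw [hq, h₁]

/-- A point e with h e joined to e' may lie over the wrong base point. Fullness of g pulls the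
projected path back to one from p e to b, and lifting it moves e into the fiber over b. -/
theorem exists_joinedIn_fiber_of_map {p : C(E, B)} {q : C(E', B')} (L : LiftingFunction p)
    (L' : LiftingFunction q)
    {h : C(E, E')} {g : C(B, B')} (hq : ∀ e, q (h e) = g (p e)) (hh : IsHomotopyEquiv h)
    (hg : IsHomotopyEquiv g) {b : B} {e' : E'} (he' : q e' = g b) :
    ∃ e, p e = b ∧ JoinedIn (q ⁻¹' {g b}) (h e) e' := by
  obtain ⟨e, ⟨D⟩⟩ := hh.exists_joined e'
  obtain ⟨δ, hδ⟩ := hg.quotient_map_surjective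
    (((Homotopic.Quotient.mk D).map q).cast (hq e).symm he'.symm : Homotopic.Quotient (g (p e)) (g b))
  induction δ with | mk δ =>
  obtain ⟨e₁, δ', hδ'⟩ := L.exists_path_lift δ
  have he₁ : p e₁ = b := by simpa using hδ' 1
  refine ⟨e₁, he₁, L'.joinedIn_fiber (by rw [hq, he₁]) he'
    (((Homotopic.Quotient.mk δ').map h).symm.trans (Homotopic.Quotient.mk D)) ?_⟩
  subst he₁
  have e₁ : ((Homotopic.Quotient.mk δ').map h).map q = ((Homotopic.Quotient.mk D).map q).cast rfl
      (by rw [he', hq]) := by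
    have h₁ := quotient_map_map_of_comm hq (Homotopic.Quotient.mk δ')
    have h₂ : (Homotopic.Quotient.mk δ').map p = Homotopic.Quotient.mk δ := by
      rw [← Homotopic.Quotient.mk_map]; congr 1; ext t; exact hδ' t
    rw [h₂, hδ] at h₁
    have := congrArg (fun u => u.cast (hq e) (hq _)) h₁
    simp only [Homotopic.Quotient.cast_cast, Homotopic.Quotient.cast_rfl_rfl] at this
    exact this.symm
  rw [quotient_map_trans, quotient_map_symm, e₁]
  have key : ∀ {x y y' c : B'} (z : Homotopic.Quotient x y) (hy : y' = y) (hc : y' = c)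
      (hc' : y = c), (z.cast rfl hy).symm.trans z = (Homotopic.Quotient.refl c).cast hc hc' := by
    rintro x y _ _ z rfl rfl _; simp
  exact key _ _ _ _

end Fiber

/-- The space of maps from a cube to `X` that are constant on the boundary, with that constant
value as part of the data. -/
abbrev FreeSphere (N X : Type*) [TopologicalSpace X] : Type _ :=
  {w : X × C(I^N, X) // ∀ y ∈ Cube.boundary N, w.2 y = w.1}

/-! ### Cubes with constant boundary value. -/

namespace FreeSphere

variable {N X Y Z : Type*} [TopologicalSpace X] [TopologicalSpace Y] [TopologicalSpace Z]

theorem continuous_of {f : Z → FreeSphere N X} (h₁ : Continuous fun z => (f z).1.1)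
    (h₂ : Continuous fun p : Z × (I^N) => (f p.1).1.2 p.2) : Continuous f :=
  continuous_induced_rng.2 (h₁.prodMk (ContinuousMap.continuous_of_continuous_uncurry _ h₂))

theorem continuous_apply {f : Z → FreeSphere N X} {g : Z → (I^N)} (hf : Continuous f)
    (hg : Continuous g) : Continuous fun z => (f z).1.2 (g z) := by
  have : Continuous fun z => (f z).1.2 := (continuous_snd.comp continuous_subtype_val).comp hf
  fun_prop

theorem ext {v w : FreeSphere N X} (h₁ : v.1.1 = w.1.1) (h₂ : ∀ y, v.1.2 y = w.1.2 y) : v = w :=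
  Subtype.ext (Prod.ext h₁ (ContinuousMap.ext h₂))

/-- The value on the boundary. -/
def ev : C(FreeSphere N X, X) := ⟨fun w => w.1.1, by fun_prop⟩

/-- Postcomposition with a map. -/
def map (f : C(X, Y)) : C(FreeSphere N X, FreeSphere N Y) where
  toFun w := ⟨(f w.1.1, f.comp w.1.2), fun y hy => congrArg f (w.2 y hy)⟩
  continuous_toFun := continuous_of (by fun_prop)
    (f.continuous.comp (continuous_apply continuous_fst continuous_snd))

/-- Postcomposition with a homotopy. -/
def mapHomotopy {f g : C(X, Y)} (F : f.Homotopy g) :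
    (map (N := N) f).Homotopy (map (N := N) g) where
  toFun p := ⟨(F (p.1, p.2.1.1), (F.toContinuousMap.curry p.1).comp p.2.1.2),
    fun y hy => congrArg (fun x => F (p.1, x)) (p.2.2 y hy)⟩
  continuous_toFun := continuous_of (by fun_prop)
    (F.continuous.comp ((continuous_fst.comp continuous_fst).prodMk
      (continuous_apply (continuous_snd.comp continuous_fst) continuous_snd)))
  map_zero_left w := ext (F.apply_zero _) fun _ => F.apply_zero _
  map_one_left w := ext (F.apply_one _) fun _ => F.apply_one _

theorem isHomotopyEquiv_map {h : C(X, Y)} (hh : IsHomotopyEquiv h) :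
    IsHomotopyEquiv (map (N := N) h) := by
  obtain ⟨k, ⟨F⟩, ⟨G⟩⟩ := hh
  exact ⟨map k, ⟨mapHomotopy F⟩, ⟨mapHomotopy G⟩⟩

/-- The constant map. -/
def const : C(X, FreeSphere N X) where
  toFun x := ⟨(x, .const _ x), fun _ _ => rfl⟩
  continuous_toFun := continuous_of continuous_id (by fun_prop)

/-- Elements of `Ω^N X x` as elements of `FreeSphere N X`. -/
def ofGenLoop {x : X} (u : Ω^ N X x) : FreeSphere N X := ⟨(x, u.1), u.2⟩

theorem exists_ofGenLoop {x : X} {w : FreeSphere N X} (h : ev w = x) :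
    ∃ u : Ω^ N X x, ofGenLoop u = w := by
  subst h
  exact ⟨⟨w.1.2, w.2⟩, rfl⟩

theorem homotopic_iff_joinedIn {x : X} {u v : Ω^ N X x} :
    GenLoop.Homotopic u v ↔ JoinedIn (ev ⁻¹' {x}) (ofGenLoop u) (ofGenLoop v) := by
  constructor
  · rintro ⟨H⟩
    refine ⟨⟨⟨fun t => ⟨(x, H.toContinuousMap.curry t), fun y hy => ?_⟩, ?_⟩, ?_, ?_⟩, ?_⟩
    · exact (H.eq_fst t hy).trans (u.2 y hy)
    · exact continuous_of (by fun_prop) (by fun_prop)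
    · exact ext rfl fun y => H.apply_zero y
    · exact ext rfl fun y => H.apply_one y
    · exact fun t => rfl
  · rintro ⟨D, hD⟩
    refine ⟨⟨⟨⟨fun p => (D p.1).1.2 p.2, ?_⟩, ?_, ?_⟩, ?_⟩⟩
    · exact continuous_apply (by fun_prop) (by fun_prop)
    · intro y
      change (D 0).1.2 y = u.1 y
      rw [D.source]; rfl
    · intro y
      change (D 1).1.2 y = v.1 y
      rw [D.target]; rfl
    · intro t y hy
      exact ((D t).2 y hy).trans ((hD t).trans (u.2 y hy).symm)

end FreeSphere

open FreeSphere

/-! ### Lifting functions for spaces of cubes, and concatenation of cubes. -/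

section Lifting

variable {E B : Type*} [TopologicalSpace E] [TopologicalSpace B]

/-- A lifting function for `p` gives one for the maps of cubes. -/
noncomputable def LiftingFunction.freeSphere (N : Type*) {p : C(E, B)} (L : LiftingFunction p) :
    LiftingFunction (FreeSphere.map (N := N) p) := by
  let c₀ : C(Delta (FreeSphere.map (N := N) p), Delta p) :=
    ⟨fun d => ⟨(d.1.1.1.1, ev.comp d.1.2), congrArg (fun w => w.1.1) d.2⟩, by
      refine Continuous.subtype_mk (Continuous.prodMk (by fun_prop) ?_) _
      exact (ContinuousMap.continuous_postcomp ev).comp (by fun_prop)⟩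
  let c₁ : C(Delta (FreeSphere.map (N := N) p) × (I^N), Delta p) :=
    ⟨fun d => ⟨(d.1.1.1.1.2 d.2, ⟨fun t => (d.1.1.2 t).1.2 d.2,
        continuous_apply (by fun_prop) continuous_const⟩),
        congrArg (fun w => w.1.2 d.2) d.1.2⟩, by
      refine Continuous.subtype_mk (Continuous.prodMk (by fun_prop) ?_) _
      exact ContinuousMap.continuous_of_continuous_uncurry _
        (continuous_apply (f := fun q : (Delta (FreeSphere.map (N := N) p) × (I^N)) × I =>
          q.1.1.1.2 q.2) (by fun_prop) (by fun_prop))⟩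
  have hc : ∀ d, ∀ y ∈ Cube.boundary N, c₁ (d, y) = c₀ d := fun d y hy =>
    Subtype.ext (Prod.ext (d.1.1.2 y hy) (ContinuousMap.ext fun t => (d.1.2 t).2 y hy))
  have hL : Continuous fun q : Delta p × I => L.toMap q.1 q.2 := by fun_prop
  let l : C(Delta (FreeSphere.map (N := N) p) × I, FreeSphere N E) :=
    ⟨fun q => ⟨(L.toMap (c₀ q.1) q.2, ⟨fun y => L.toMap (c₁ (q.1, y)) q.2, by fun_prop⟩),
      fun y hy => by simp [hc q.1 y hy]⟩,
      continuous_of (by fun_prop) (by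
        exact hL.comp (f := fun q : (Delta (FreeSphere.map (N := N) p) × I) × (I^N) =>
          (c₁ (q.1.1, q.2), q.1.2)) (by fun_prop))⟩
  exact
    { toMap := l.curry
      start := fun d => FreeSphere.ext (L.start _) fun y => L.start _
      lifts := fun d => ContinuousMap.ext fun t => FreeSphere.ext
        (DFunLike.congr_fun (L.lifts (c₀ d)) t)
        fun y => DFunLike.congr_fun (L.lifts (c₁ (d, y))) t }

/-- The radial coordinate of the cube, which is `1` on the boundary. -/
noncomputable def cubeRadius {N : Type*} [Fintype N] (y : I^N) : ℝ := ‖fun i => 2 * (y i : ℝ) - 1‖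

/-- The cube, stretched by the factor `1 + t` from its centre and cut off. -/
noncomputable def cubeStretch {N : Type*} (t : I) (y : I^N) : I^N :=
  fun i => Set.projIcc 0 1 zero_le_one (1 / 2 + (1 + t) * ((y i : ℝ) - 1 / 2))

section Cube

variable {N : Type*}

theorem continuous_cubeStretch :
    Continuous fun q : I × (I^N) => cubeStretch q.1 q.2 := by
  unfold cubeStretch
  refine continuous_pi fun i => continuous_projIcc.comp (by fun_prop)

theorem cubeStretch_zero (y : I^N) : cubeStretch 0 y = y := by
  funext i
  simp [cubeStretch]

variable [Fintype N]

@[fun_prop]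
theorem continuous_cubeRadius : Continuous (cubeRadius (N := N)) := by
  unfold cubeRadius; fun_prop

theorem cubeRadius_le_one (y : I^N) : cubeRadius y ≤ 1 := by
  refine (pi_norm_le_iff_of_nonneg zero_le_one).2 fun i => ?_
  rw [Real.norm_eq_abs, abs_le]
  have := (y i).2
  constructor <;> linarith [this.1, this.2]

theorem cubeRadius_of_mem_boundary {y : I^N} (hy : y ∈ Cube.boundary N) : cubeRadius y = 1 := by
  refine le_antisymm (cubeRadius_le_one y) ?_
  obtain ⟨i, hi⟩ := hy
  have h : |2 * (y i : ℝ) - 1| = 1 := by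
    rcases hi with hi | hi <;> norm_num [hi]
  exact h.symm.le.trans (norm_le_pi_norm (fun i => 2 * (y i : ℝ) - 1) i)

/-- Some stretched coordinate reaches or passes an end of the interval, and the cut-off puts it at
that end. This makes the two pieces in `liftingFunctionEv` agree where they meet. -/
theorem cubeStretch_mem_boundary {t : I} {y : I^N} (h : 1 ≤ (1 + (t : ℝ)) * cubeRadius y) :
    cubeStretch t y ∈ Cube.boundary N := by
  by_contra hn
  have ht := t.2.1
  have hlt : ‖fun i => (1 + (t : ℝ)) * (2 * (y i : ℝ) - 1)‖ < 1 := by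
    refine (pi_norm_lt_iff zero_lt_one).2 fun i => ?_
    by_contra hi
    refine hn ⟨i, ?_⟩
    rw [not_lt, Real.norm_eq_abs, le_abs] at hi
    rcases hi with hi | hi
    · exact Or.inr (Set.projIcc_of_right_le _ (by linarith))
    · exact Or.inl (Set.projIcc_of_le_left _ (by linarith))
  have : (fun i => (1 + (t : ℝ)) * (2 * (y i : ℝ) - 1)) =
      (1 + (t : ℝ)) • fun i => 2 * (y i : ℝ) - 1 := rfl
  rw [this, norm_smul, Real.norm_of_nonneg (by linarith)] at hlt
  exact absurd h (not_le.2 hlt)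

variable {X : Type*} [TopologicalSpace X]

/-- Evaluation on the boundary is a fibration. -/
noncomputable def liftingFunctionEv : LiftingFunction (ev : C(FreeSphere N X, X)) := by
  -- At time t the given cube is shrunk by the factor 1 + t towards the centre, and the collar
  -- around it runs radially along the path from time 0 to time t.
  let F : Delta (ev : C(FreeSphere N X, X)) × I × (I^N) → X := fun q =>
    if (1 + (q.2.1 : ℝ)) * cubeRadius q.2.2 ≤ 1 then q.1.1.1.1.2 (cubeStretch q.2.1 q.2.2)
    else q.1.1.2 (Set.projIcc 0 1 zero_le_one ((1 + (q.2.1 : ℝ)) * cubeRadius q.2.2 - 1))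
  have hF : Continuous F := by
    refine Continuous.if_le (continuous_apply (by fun_prop) ?_) ?_ (by fun_prop) (by fun_prop) ?_
    · exact continuous_cubeStretch.comp continuous_snd
    · have : Continuous fun q : Delta (ev : C(FreeSphere N X, X)) × I × (I^N) =>
        Set.projIcc (0 : ℝ) 1 zero_le_one ((1 + (q.2.1 : ℝ)) * cubeRadius q.2.2 - 1) :=
        continuous_projIcc.comp (by fun_prop)
      fun_prop
    · intro q hq
      rw [q.1.1.1.2 _ (cubeStretch_mem_boundary hq.ge)]
      simp only [hq, sub_self, Set.projIcc_left]
      exact q.1.2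
  have hb : ∀ d t, ∀ y ∈ Cube.boundary N, F (d, t, y) = d.1.2 t := by
    intro d t y hy
    simp only [F, cubeRadius_of_mem_boundary hy, mul_one, add_sub_cancel_left,
      Set.projIcc_val]
    split_ifs with h
    · obtain rfl : t = 0 := le_antisymm (Subtype.coe_le_coe.1 (by simpa using h)) t.2.1
      rw [cubeStretch_zero, d.1.1.2 y hy]
      exact d.2
    · rfl
  let l : C(Delta (ev : C(FreeSphere N X, X)) × I, FreeSphere N X) :=
    ⟨fun q => ⟨(q.1.1.2 q.2, ⟨fun y => F (q.1, q.2, y), by fun_prop⟩), hb q.1 q.2⟩,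
      continuous_of (by fun_prop) (by
        exact hF.comp (f := fun q : (Delta (ev : C(FreeSphere N X, X)) × I) × (I^N) =>
          (q.1.1, q.1.2, q.2)) (by fun_prop))⟩
  exact
    { toMap := l.curry
      start := fun d => FreeSphere.ext d.2.symm fun y => by
        change F (d, 0, y) = _
        have : (1 + ((0 : I) : ℝ)) * cubeRadius y ≤ 1 := by simpa using cubeRadius_le_one y
        simp only [F, if_pos this, cubeStretch_zero]
      lifts := fun d => rfl }

end Cube

section Glue

variable {N : Type*} [DecidableEq N] {X : Type*} [TopologicalSpace X]

/-- Concatenation, along a coordinate, of two maps of cubes with the same value on the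
boundary. -/
noncomputable def FreeSphere.glue (i : N) :
    C({q : FreeSphere N X × FreeSphere N X // ev q.1 = ev q.2}, FreeSphere N X) := by
  let F : {q : FreeSphere N X × FreeSphere N X // ev q.1 = ev q.2} × (I^N) → X := fun q =>
    if (q.2 i : ℝ) ≤ 1 / 2 then
      q.1.1.1.1.2 (Function.update q.2 i (Set.projIcc 0 1 zero_le_one (2 * (q.2 i : ℝ))))
    else q.1.1.2.1.2 (Function.update q.2 i (Set.projIcc 0 1 zero_le_one (2 * (q.2 i : ℝ) - 1)))
  have hmem : ∀ (y : I^N) (s : I), s = 0 ∨ s = 1 → Function.update y i s ∈ Cube.boundary N :=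
    fun y s hs => ⟨i, by simpa using hs⟩
  have hF : Continuous F := by
    refine Continuous.if_le (continuous_apply (by fun_prop) ?_) (continuous_apply (by fun_prop) ?_)
      (by fun_prop) (by fun_prop) ?_
    · exact Continuous.update (by fun_prop) i (continuous_projIcc.comp (by fun_prop))
    · exact Continuous.update (by fun_prop) i (continuous_projIcc.comp (by fun_prop))
    · intro q hq
      rw [q.1.1.1.2 _ (hmem _ _ ?_), q.1.1.2.2 _ (hmem _ _ ?_)]
      · exact q.1.2
      · left; simp [hq]
      · right; simp [hq]
  refine ⟨fun q => ⟨(ev q.1.1, ⟨fun y => F (q, y), by fun_prop⟩), ?_⟩,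
    continuous_of (by fun_prop) hF⟩
  rintro y ⟨j, hj⟩
  have hmem' : ∀ s : I, (j = i → s = 0 ∨ s = 1) → Function.update y i s ∈ Cube.boundary N := by
    intro s hs
    refine ⟨j, ?_⟩
    by_cases h : j = i
    · subst h; simpa using hs rfl
    · simpa [Function.update_of_ne h] using hj
  change F (q, y) = _
  simp only [F]
  split_ifs with hy
  · refine q.1.1.2 _ (hmem' _ ?_)
    rintro rfl
    rcases hj with hj | hj
    · left; simp [hj]
    · norm_num [hj] at hy
  · refine (q.1.2.2 _ (hmem' _ ?_)).trans q.2.symm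
    rintro rfl
    rcases hj with hj | hj
    · norm_num [hj] at hy
    · right; norm_num [hj]

theorem FreeSphere.glue_ofGenLoop (i : N) {x : X} (u v : Ω^ N X x) :
    glue i ⟨(ofGenLoop u, ofGenLoop v), rfl⟩ = ofGenLoop (GenLoop.transAt i u v) := rfl

end Glue

end Lifting

open Path FreeSphere

/-! ### Homotopies between operations on path spaces. -/

section PathFamilies

variable {X Z : Type*} [TopologicalSpace X] [TopologicalSpace Z]

/-- A continuous family of path homotopies, as a homotopy of maps into the path space. -/
def homotopyOfFamily {x y : X} {f g : C(Z, Path x y)} (H : ∀ z, (f z).Homotopy (g z))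
    (hH : Continuous fun q : Z × I × I => H q.1 q.2) : f.Homotopy g where
  toFun p := (H p.2).eval p.1
  continuous_toFun := Path.continuous_uncurry_iff.1
    (hH.comp (f := fun q : (I × Z) × I => (q.1.2, q.1.1, q.2)) (by fun_prop))
  map_zero_left z := (H z).eval_zero
  map_one_left z := (H z).eval_one

theorem homotopic_trans_refl (x y : X) :
    (ContinuousMap.id (Path x y)).Homotopic
      ⟨fun p => p.trans (Path.refl y), by fun_prop⟩ := by
  refine ContinuousMap.Homotopic.symm
    ⟨homotopyOfFamily (fun p => Path.Homotopy.transRefl p) ?_⟩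
  -- Each of these homotopies only reparametrizes the path, by a formula independent of it, so
  -- continuity in the path as well can be read off.
  change Continuous fun q : Path x y × I × I => q.1
    ⟨(σ (σ q.2.1) : ℝ) * q.2.2 + (σ q.2.1 : ℝ) * Path.Homotopy.transReflReparamAux q.2.2, _⟩
  fun_prop

theorem homotopic_refl_trans (x y : X) :
    (ContinuousMap.id (Path x y)).Homotopic
      ⟨fun p => (Path.refl x).trans p, by fun_prop⟩ := by
  refine ContinuousMap.Homotopic.symm
    ⟨homotopyOfFamily (fun p => Path.Homotopy.reflTrans p) ?_⟩
  change Continuous fun q : Path x y × I × I => q.1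
    (σ ⟨(σ (σ q.2.1) : ℝ) * (σ q.2.2 : ℝ) +
      (σ q.2.1 : ℝ) * Path.Homotopy.transReflReparamAux (σ q.2.2), _⟩)
  fun_prop

theorem homotopic_trans_symm (x y : X) :
    (ContinuousMap.const (Path x y) (Path.refl x)).Homotopic
      ⟨fun p => p.trans p.symm, by have := continuous_symm (x := x) (y := y); fun_prop⟩ := by
  refine ⟨homotopyOfFamily (fun p => Path.Homotopy.reflTransSymm p) ?_⟩
  change Continuous fun q : Path x y × I × I => q.1 ⟨_, Path.Homotopy.reflTransSymmAux_mem_I q.2⟩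
  fun_prop

end PathFamilies

/-! ### Free and based homotopy in loop spaces. -/

section Simple

variable {N S : Type*} [Fintype N] [TopologicalSpace S]

theorem homotopic_of_map_ev_eq_refl {x : S} {u v : Ω^ N S x}
    (d : Homotopic.Quotient (ofGenLoop u) (ofGenLoop v))
    (hd : d.map ev = Homotopic.Quotient.refl x) : GenLoop.Homotopic u v :=
  homotopic_iff_joinedIn.2 (liftingFunctionEv.joinedIn_fiber rfl rfl d
    (hd.trans (Homotopic.Quotient.cast_rfl_rfl _).symm))

/-- In a loop space, the fundamental group acts trivially on the homotopy groups. -/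
theorem homotopic_of_joined {s : S} {u v : Ω^ N (Path s s) (Path.refl s)}
    (h : Joined (ofGenLoop u) (ofGenLoop v)) : GenLoop.Homotopic u v := by
  obtain ⟨D⟩ := h
  let c : Path s s := Path.refl s
  let r : C(Path s s, Path s s) := ⟨fun p => p.trans c, by fun_prop⟩
  let q : C(Path s s, Path s s) := ⟨fun p => p.trans p.symm, by
    have := continuous_symm (x := s) (y := s); fun_prop⟩
  obtain ⟨ρ⟩ : (ContinuousMap.id (Path s s)).Homotopic r := homotopic_trans_refl s s
  obtain ⟨κ⟩ : (ContinuousMap.const (Path s s) c).Homotopic q := homotopic_trans_symm s s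
  have hD : Continuous fun t : I => D t := D.continuous
  have hm : Continuous fun p : Path s s × Path s s => p.1.trans p.2.symm := by
    have := continuous_symm (x := s) (y := s); fun_prop
  -- Each cube of the free homotopy is multiplied by the inverse of its boundary value γ(t), which
  -- makes the new boundary value γ(t)·γ(t)⁻¹. At both ends γ is the constant loop, so there only
  -- `r` is applied.
  let D' : Path (FreeSphere.map r (ofGenLoop u)) (FreeSphere.map r (ofGenLoop v)) :=
    { toFun := fun t => ⟨((D t).1.1.trans (D t).1.1.symm,
          ⟨fun y => ((D t).1.2 y).trans (D t).1.1.symm, by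
            exact hm.comp (f := fun y => ((D t).1.2 y, (D t).1.1)) (by fun_prop)⟩),
          fun y hy => congrArg (fun p => Path.trans p (D t).1.1.symm) ((D t).2 y hy)⟩
      continuous_toFun := FreeSphere.continuous_of
        (hm.comp (f := fun t => ((D t).1.1, (D t).1.1)) (by fun_prop))
        (hm.comp (f := fun q : I × (I^N) => ((D q.1).1.2 q.2, (D q.1).1.1))
          ((FreeSphere.continuous_apply (by fun_prop) (by fun_prop)).prodMk (by fun_prop)))
      source' := FreeSphere.ext (by simp only [D.source]; rfl)
        fun y => by simp only [D.source]; rfl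
      target' := FreeSphere.ext (by simp only [D.target]; rfl)
        fun y => by simp only [D.target]; rfl }
  let R := FreeSphere.mapHomotopy (N := N) ρ
  have hR : ∀ w : Ω^ N (Path s s) c, (Homotopic.Quotient.mk (R.evalAt (ofGenLoop w))).map ev =
      Homotopic.Quotient.mk (ρ.evalAt c) := fun w => rfl
  let γ : Path c c := D.map ev.continuous
  -- The boundary trace is the image of γ under p ↦ p·p⁻¹, which is homotopic to a constant map.
  have hD' : (Homotopic.Quotient.mk D').map ev = Homotopic.Quotient.refl (r c) := by
    have h₁ : (Homotopic.Quotient.mk D').map ev = (Homotopic.Quotient.mk γ).map q := rfl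
    have h₂ := quotient_map_trans_evalAt κ (Homotopic.Quotient.mk γ)
    have h₃ : (Homotopic.Quotient.mk γ).map (ContinuousMap.const (Path s s) c) =
      Homotopic.Quotient.refl c := rfl
    rw [h₁]
    refine quotient_trans_left_cancel (h₂.symm.trans ?_)
    rw [h₃]
    exact (Homotopic.Quotient.refl_trans _).trans (Homotopic.Quotient.trans_refl _).symm
  let d : Homotopic.Quotient (ofGenLoop u) (ofGenLoop v) :=
    (Homotopic.Quotient.mk (R.evalAt (ofGenLoop u))).trans
      ((Homotopic.Quotient.mk D').trans (Homotopic.Quotient.mk (R.evalAt (ofGenLoop v))).symm)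
  refine homotopic_of_map_ev_eq_refl d ?_
  have h : d.map ev = (Homotopic.Quotient.mk (ρ.evalAt c)).trans
      ((Homotopic.Quotient.refl (r c)).trans (Homotopic.Quotient.mk (ρ.evalAt c)).symm) := by
    rw [← hD', ← hR u]
    refine (quotient_map_trans _ _ _).trans (congrArg _ ((quotient_map_trans _ _ _).trans
      (congrArg _ (quotient_map_symm _ _))))
  rw [h, Homotopic.Quotient.refl_trans]
  exact Homotopic.Quotient.trans_symm _

theorem exists_path_ofGenLoop {x : S} (w : FreeSphere N S) (ε : Path (ev w) x) :
    ∃ (u : Ω^ N S x) (D : Path w (ofGenLoop u)), ∀ t, ev (D t) = ε t := by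
  obtain ⟨w', D, hD⟩ := liftingFunctionEv.exists_path_lift ε
  have : ev w' = x := by simpa using hD 1
  obtain ⟨u, rfl⟩ := exists_ofGenLoop this
  exact ⟨u, D, hD⟩

end Simple

/-! ### From bijections on free classes to isomorphisms of homotopy groups. -/

section MulEquiv

variable {N S₁ S₂ : Type*} [Fintype N] [DecidableEq N] [Nonempty N] [TopologicalSpace S₁]
  [TopologicalSpace S₂]

/-- A map of loop spaces that is bijective on free homotopy classes of maps of cubes that are
constant on the boundary induces an isomorphism of homotopy groups. -/
theorem nonempty_mulEquiv_of_bijective {s₁ : S₁} {s₂ : S₂} (φ : C(Path s₁ s₁, Path s₂ s₂))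
    (hc : Joined (φ (Path.refl s₁)) (Path.refl s₂))
    (hinj : ∀ v w : FreeSphere N (Path s₁ s₁),
      Joined (FreeSphere.map φ v) (FreeSphere.map φ w) → Joined v w)
    (hsurj : ∀ w' : FreeSphere N (Path s₂ s₂), ∃ w, Joined (FreeSphere.map φ w) w') :
    Nonempty (HomotopyGroup N (Path s₁ s₁) (Path.refl s₁) ≃*
      HomotopyGroup N (Path s₂ s₂) (Path.refl s₂)) := by
  obtain ⟨ε⟩ := id hc
  -- The boundary values are all moved along the same path ε, so the tracks `D u` and `D v` can be
  -- glued at every time; this gives multiplicativity.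
  choose τ D hD using fun u : Ω^ N (Path s₁ s₁) (Path.refl s₁) =>
    exists_path_ofGenLoop (FreeSphere.map φ (ofGenLoop u)) ε
  have hτ : ∀ u, Joined (FreeSphere.map φ (ofGenLoop u)) (ofGenLoop (τ u)) := fun u => ⟨D u⟩
  have joined_of : ∀ {u v : Ω^ N (Path s₁ s₁) (Path.refl s₁)}, GenLoop.Homotopic u v →
      Joined (ofGenLoop u) (ofGenLoop v) := fun h => (homotopic_iff_joinedIn.1 h).joined
  have joined_of' : ∀ {u v : Ω^ N (Path s₂ s₂) (Path.refl s₂)}, GenLoop.Homotopic u v →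
      Joined (ofGenLoop u) (ofGenLoop v) := fun h => (homotopic_iff_joinedIn.1 h).joined
  have hwd : ∀ u v, GenLoop.Homotopic u v → GenLoop.Homotopic (τ u) (τ v) := fun u v h =>
    homotopic_of_joined
      (((hτ u).symm.trans ((joined_of h).map (FreeSphere.map φ).continuous)).trans (hτ v))
  let i : N := Classical.arbitrary N
  have hmul : ∀ u v, GenLoop.Homotopic (τ (GenLoop.transAt i u v))
      (GenLoop.transAt i (τ u) (τ v)) := by
    intro u v
    refine homotopic_of_joined ((hτ _).symm.trans ?_)
    let A : I → {q : FreeSphere N (Path s₂ s₂) × FreeSphere N (Path s₂ s₂) // ev q.1 = ev q.2} :=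
      fun t => ⟨(D u t, D v t), (hD u t).trans (hD v t).symm⟩
    have hA : Continuous A := by fun_prop
    refine ⟨⟨⟨fun t => glue i (A t), by fun_prop⟩, ?_, ?_⟩⟩
    · have : A 0 = ⟨(FreeSphere.map φ (ofGenLoop u), FreeSphere.map φ (ofGenLoop v)), rfl⟩ :=
        Subtype.ext (Prod.ext (D u).source (D v).source)
      change glue i (A 0) = _
      rw [this]
      exact FreeSphere.ext rfl fun y => (apply_ite φ _ _ _).symm
    · have : A 1 = ⟨(ofGenLoop (τ u), ofGenLoop (τ v)), rfl⟩ :=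
        Subtype.ext (Prod.ext (D u).target (D v).target)
      change glue i (A 1) = _
      rw [this]
      exact glue_ofGenLoop i _ _
  let Φ : HomotopyGroup N (Path s₁ s₁) (Path.refl s₁) →
      HomotopyGroup N (Path s₂ s₂) (Path.refl s₂) := Quotient.map τ hwd
  have hΦmul : ∀ a b, Φ (a * b) = Φ a * Φ b := by
    intro a b
    induction a, b using Quotient.inductionOn₂ with
    | _ u v =>
    have h₁ := HomotopyGroup.mul_spec (i := i) (p := u) (q := v)
    have h₂ := HomotopyGroup.mul_spec (i := i) (p := τ u) (q := τ v)
    -- The factors are swapped because `HomotopyGroup.mul_spec` represents a product by the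
    -- concatenation in reverse order.
    exact (congrArg Φ h₁).trans ((Quotient.sound (hmul v u)).trans h₂.symm)
  refine ⟨MulEquiv.ofBijective (MonoidHom.mk' Φ hΦmul) ⟨?_, ?_⟩⟩
  · intro a b
    induction a, b using Quotient.inductionOn₂ with
    | _ u v =>
    intro h
    have h' : GenLoop.Homotopic (τ u) (τ v) := Quotient.exact h
    exact Quotient.sound (homotopic_of_joined
      (hinj _ _ (((hτ u).trans (joined_of' h')).trans (hτ v).symm)))
  · intro b
    induction b using Quotient.inductionOn with
    | _ v =>
    obtain ⟨w, hw⟩ := hsurj (ofGenLoop v)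
    -- Injectivity applied to constant cubes puts the boundary value of w in the component of the
    -- constant loop.
    have hev : Joined (ev w) (Path.refl s₁) := by
      have h₁ : Joined (φ (ev w)) (φ (Path.refl s₁)) :=
        (hw.map ev.continuous).trans hc.symm
      exact (hinj (FreeSphere.const (ev w)) (FreeSphere.const (Path.refl s₁))
        (h₁.map FreeSphere.const.continuous)).map ev.continuous
    obtain ⟨u, D', -⟩ := exists_path_ofGenLoop w hev.somePath
    refine ⟨⟦u⟧, Quotient.sound (homotopic_of_joined ?_)⟩
    exact ((hτ u).symm.trans
      ((Joined.map ⟨D'.symm⟩ (FreeSphere.map φ).continuous))).trans hw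

end MulEquiv

/-! ### The shift of homotopy groups under looping. -/

section LoopShift

variable {S : Type*} [TopologicalSpace S] {s : S} {n : ℕ}

/-- Adjunction between spheres in the loop space and spheres of one dimension more. -/
def genLoopUncurry (u : Ω^ (Fin n) (Path s s) (Path.refl s)) : Ω^ (Fin (n + 1)) S s :=
  ⟨⟨fun y => u (Fin.tail y) (y 0), by
    have : Continuous fun y : I^ (Fin (n + 1)) => u.1 (Fin.tail y) := by
      unfold Fin.tail; fun_prop
    exact this.eval (by fun_prop)⟩, by
    rintro y ⟨i, hi⟩
    change u (Fin.tail y) (y 0) = s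
    cases i using Fin.cases with
    | zero => rcases hi with hi | hi <;> simp [hi]
    | succ j =>
      exact congrArg (fun p : Path s s => p (y 0)) (u.2 (Fin.tail y) ⟨j, hi⟩)⟩

/-- The inverse of `genLoopUncurry`. -/
def genLoopCurry (v : Ω^ (Fin (n + 1)) S s) : Ω^ (Fin n) (Path s s) (Path.refl s) :=
  ⟨⟨fun y => ⟨⟨fun t => v (Fin.cons t y), by
      have : Continuous fun t : I => (Fin.cons t y : I^ (Fin (n + 1))) := by fun_prop
      exact v.1.continuous.comp this⟩,
      v.2 _ ⟨0, Or.inl rfl⟩, v.2 _ ⟨0, Or.inr rfl⟩⟩, by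
      refine Path.continuous_uncurry_iff.1 ?_
      have : Continuous fun q : (I^ (Fin n)) × I => (Fin.cons q.2 q.1 : I^ (Fin (n + 1))) := by
        fun_prop
      exact v.1.continuous.comp this⟩, by
    rintro y ⟨i, hi⟩
    ext t
    exact v.2 _ ⟨i.succ, by simpa using hi⟩⟩

theorem homotopic_uncurry {u v : Ω^ (Fin n) (Path s s) (Path.refl s)}
    (h : GenLoop.Homotopic u v) : GenLoop.Homotopic (genLoopUncurry u) (genLoopUncurry v) := by
  obtain ⟨H⟩ := h
  have hc : Continuous fun q : I × (I^ (Fin (n + 1))) => H (q.1, Fin.tail q.2) := by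
    unfold Fin.tail; fun_prop
  refine ⟨⟨⟨⟨fun q => H (q.1, Fin.tail q.2) (q.2 0), hc.eval (by fun_prop)⟩, ?_, ?_⟩, ?_⟩⟩
  · intro y; exact congrArg (fun p : Path s s => p (y 0)) (H.apply_zero _)
  · intro y; exact congrArg (fun p : Path s s => p (y 0)) (H.apply_one _)
  · intro t y hy
    refine Eq.trans ?_ ((genLoopUncurry u).2 y hy).symm
    obtain ⟨i, hi⟩ := hy
    change H (t, Fin.tail y) (y 0) = s
    cases i using Fin.cases with
    | zero => rcases hi with hi | hi <;> simp [hi]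
    | succ j =>
      rw [H.eq_fst t (x := Fin.tail y) ⟨j, hi⟩]
      exact (congrArg (fun p : Path s s => p (y 0)) (u.2 (Fin.tail y) ⟨j, hi⟩))

theorem homotopic_curry {u v : Ω^ (Fin (n + 1)) S s}
    (h : GenLoop.Homotopic u v) : GenLoop.Homotopic (genLoopCurry u) (genLoopCurry v) := by
  obtain ⟨H⟩ := h
  have hH : ∀ (t : I) (y : I^ (Fin (n + 1))), y ∈ Cube.boundary (Fin (n + 1)) → H (t, y) = s :=
    fun t y hy => (H.eq_fst t hy).trans (u.2 y hy)
  have hc : Continuous fun q : (I × (I^ (Fin n))) × I =>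
      H (q.1.1, (Fin.cons q.2 q.1.2 : I^ (Fin (n + 1)))) := by fun_prop
  refine ⟨⟨⟨⟨fun q => ⟨⟨fun t => H (q.1, (Fin.cons t q.2 : I^ (Fin (n + 1)))),
    hc.comp (Continuous.prodMk_right q)⟩,
    hH _ _ ⟨0, Or.inl rfl⟩, hH _ _ ⟨0, Or.inr rfl⟩⟩, Path.continuous_uncurry_iff.1 hc⟩,
    ?_, ?_⟩, ?_⟩⟩
  · intro y; ext t; exact H.apply_zero _
  · intro y; ext t; exact H.apply_one _
  · rintro t y ⟨i, hi⟩
    ext t'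
    exact H.eq_fst t (x := Fin.cons t' y) ⟨i.succ, by simpa using hi⟩

/-- The loop parameter is coordinate 0, so concatenation along any other coordinate leaves it alone.
-/
theorem genLoopUncurry_transAt (i : Fin n) (u v : Ω^ (Fin n) (Path s s) (Path.refl s)) :
    genLoopUncurry (GenLoop.transAt i u v) =
      GenLoop.transAt i.succ (genLoopUncurry u) (genLoopUncurry v) := by
  ext y
  have ht : ∀ z : I, Fin.tail (Function.update y i.succ z) = Function.update (Fin.tail y) i z :=
    fun z => Fin.tail_update_succ y i z
  have h0 : ∀ z : I, Function.update y i.succ z 0 = y 0 := fun z =>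
    Function.update_of_ne (Fin.succ_ne_zero i).symm _ _
  have hL : ∀ a b : I, (if (y i.succ : ℝ) ≤ 1 / 2 then u (Function.update (Fin.tail y) i a)
      else v (Function.update (Fin.tail y) i b) : Path s s) (y 0) =
      if (y i.succ : ℝ) ≤ 1 / 2 then
        u (Fin.tail (Function.update y i.succ a)) (Function.update y i.succ a 0)
      else v (Fin.tail (Function.update y i.succ b)) (Function.update y i.succ b 0) := by
    intro a b
    simp only [ht, h0]
    split_ifs <;> rfl
  exact hL _ _

/-- The homotopy groups of the loop space. -/
def homotopyGroupLoopEquiv (n : ℕ) (s : S) :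
    π_ (n + 1) (Path s s) (Path.refl s) ≃* π_ (n + 2) S s where
  toFun := Quotient.map genLoopUncurry fun _ _ h => homotopic_uncurry h
  invFun := Quotient.map genLoopCurry fun _ _ h => homotopic_curry h
  left_inv a := by
    induction a using Quotient.inductionOn with
    | _ u => exact congrArg _ (GenLoop.ext _ _ fun y => Path.ext (funext fun t => rfl))
  right_inv a := by
    induction a using Quotient.inductionOn with
    | _ u =>
      refine congrArg _ (GenLoop.ext _ _ fun y => ?_)
      change u (Fin.cons (y 0) (Fin.tail y)) = u y
      rw [Fin.cons_self_tail]
  map_mul' a b := by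
    induction a, b using Quotient.inductionOn₂ with
    | _ u v =>
    have h₁ := HomotopyGroup.mul_spec (i := (0 : Fin (n + 1))) (p := u) (q := v)
    have h₂ := HomotopyGroup.mul_spec (i := (0 : Fin (n + 1)).succ) (p := genLoopUncurry u)
      (q := genLoopUncurry v)
    refine (congrArg _ h₁).trans (Eq.trans ?_ h₂.symm)
    exact congrArg _ (genLoopUncurry_transAt 0 v u)

end LoopShift

/-! ### The end point fibration and its fiber. -/

section EndPoint

variable {S : Type*} [TopologicalSpace S] (F : Set S) (s : F)

/-- The end point map `Ψ_s` is a fibration. -/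
noncomputable def liftingFunctionPsi : LiftingFunction (Psi F s) := by
  -- At time t this is the given path followed by the initial piece, up to time t, of the path in F,
  -- run through at speed 1 + t.
  let G : (Delta (Psi F s) × I) × I → S := fun q =>
    if (1 + (q.1.2 : ℝ)) * q.2 ≤ 1 then
      q.1.1.1.1.1 (Set.projIcc 0 1 zero_le_one ((1 + (q.1.2 : ℝ)) * q.2))
    else q.1.1.1.2 (Set.projIcc 0 1 zero_le_one ((1 + (q.1.2 : ℝ)) * q.2 - 1))
  have hG : Continuous G := by
    have h₁ : Continuous fun q : (Delta (Psi F s) × I) × I =>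
        Set.projIcc (0 : ℝ) 1 zero_le_one ((1 + (q.1.2 : ℝ)) * q.2) :=
      continuous_projIcc.comp (by fun_prop)
    have h₂ : Continuous fun q : (Delta (Psi F s) × I) × I =>
        Set.projIcc (0 : ℝ) 1 zero_le_one ((1 + (q.1.2 : ℝ)) * q.2 - 1) :=
      continuous_projIcc.comp (by fun_prop)
    refine Continuous.if_le (by fun_prop) (by fun_prop) (by fun_prop) (by fun_prop) ?_
    intro q hq
    simp only [hq, Set.projIcc_right, sub_self, Set.projIcc_left]
    exact congrArg Subtype.val q.1.1.2
  have hG₀ : ∀ q, G (q, 0) = s := by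
    intro q
    simp only [G, Set.Icc.coe_zero, mul_zero, zero_le_one, if_true, Set.projIcc_left]
    exact q.1.1.1.2.1
  have hG₁ : ∀ q : Delta (Psi F s) × I, G (q, 1) = q.1.1.2 q.2 := by
    intro q
    simp only [G, Set.Icc.coe_one, mul_one, add_sub_cancel_left, Set.projIcc_val]
    split_ifs with h
    · have h0 : q.2 = 0 := le_antisymm (Subtype.coe_le_coe.1 (by simpa using h)) q.2.2.1
      rw [h0]
      simp only [Set.Icc.coe_zero, add_zero, Set.projIcc_right]
      exact congrArg Subtype.val q.1.2
    · rfl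
  let l : C(Delta (Psi F s) × I, Gam F s) :=
    ⟨fun q => ⟨⟨fun τ => G (q, τ), by fun_prop⟩, hG₀ q, by
        change G (q, 1) ∈ F
        rw [hG₁]; exact (q.1.1.2 q.2).2⟩,
      Continuous.subtype_mk (ContinuousMap.continuous_of_continuous_uncurry _ hG) _⟩
  exact
    { toMap := l.curry
      start := fun d => Subtype.ext (ContinuousMap.ext fun τ => by
        change G ((d, 0), τ) = _
        have : (1 + ((0 : I) : ℝ)) * (τ : ℝ) ≤ 1 := by simpa using τ.2.2
        simp only [G, if_pos this]
        simp)
      lifts := fun d => ContinuousMap.ext fun t => Subtype.ext (hG₁ (d, t)) }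

variable {F s}

/-- Loops are paths that end in `F`. -/
def loopToGam : C(Path (s : S) s, Gam F s) where
  toFun p := ⟨p.toContinuousMap, p.source, by
    change p 1 ∈ F
    rw [p.target]; exact s.2⟩
  continuous_toFun := Continuous.subtype_mk continuous_induced_dom _

/-- The fibre of `Ψ_s` consists of loops, also for families parametrized by a cube. -/
def freeSphereLoop (N : Type*) :
    C((FreeSphere.map (N := N) (Psi F s)) ⁻¹' {FreeSphere.const s},
      FreeSphere N (Path (s : S) s)) where
  toFun w := ⟨(⟨w.1.1.1.1, w.1.1.1.2.1,
      congrArg (fun v => ((v.1.1 : F) : S)) w.2⟩,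
    ⟨fun y => ⟨(w.1.1.2 y).1, (w.1.1.2 y).2.1,
      congrArg (fun v => ((v.1.2 y : F) : S)) w.2⟩, continuous_induced_rng.2 (by
        change Continuous fun y => (w.1.1.2 y).1
        fun_prop)⟩),
    fun y hy => Path.ext (congrArg (fun α : Gam F s => ⇑α.1) (w.1.2 y hy))⟩
  continuous_toFun := FreeSphere.continuous_of
    (continuous_induced_rng.2 (by
      change Continuous fun w : (FreeSphere.map (N := N) (Psi F s)) ⁻¹' {FreeSphere.const s} =>
        w.1.1.1.1
      fun_prop))
    (continuous_induced_rng.2 (by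
      change Continuous fun q :
        ((FreeSphere.map (N := N) (Psi F s)) ⁻¹' {FreeSphere.const s}) × (I^N) => (q.1.1.1.2 q.2).1
      exact continuous_subtype_val.comp (FreeSphere.continuous_apply
        (f := fun q : ((FreeSphere.map (N := N) (Psi F s)) ⁻¹' {FreeSphere.const s}) × (I^N) =>
          q.1.1) (by fun_prop) (by fun_prop))))

theorem map_psi_map_loopToGam {N : Type*} (v : FreeSphere N (Path (s : S) s)) :
    FreeSphere.map (Psi F s) (FreeSphere.map loopToGam v) = FreeSphere.const s :=
  FreeSphere.ext (Subtype.ext v.1.1.target) fun y => Subtype.ext (v.1.2 y).target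

theorem joined_of_joinedIn_fiber_psi {N : Type*} {v w : FreeSphere N (Path (s : S) s)}
    (h : JoinedIn (FreeSphere.map (Psi F s) ⁻¹' {FreeSphere.const s})
      (FreeSphere.map loopToGam v) (FreeSphere.map loopToGam w)) : Joined v w :=
  h.joined_subtype.map (freeSphereLoop N).continuous

theorem joinedIn_fiber_psi_of_joined {N : Type*} {v w : FreeSphere N (Path (s : S) s)}
    (h : Joined v w) : JoinedIn (FreeSphere.map (Psi F s) ⁻¹' {FreeSphere.const s})
      (FreeSphere.map loopToGam v) (FreeSphere.map loopToGam w) := by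
  obtain ⟨D⟩ := h
  exact ⟨D.map (FreeSphere.map loopToGam).continuous, fun t => map_psi_map_loopToGam (D t)⟩

theorem exists_map_loopToGam {N : Type*} {w : FreeSphere N (Gam F s)}
    (h : FreeSphere.map (Psi F s) w = FreeSphere.const s) :
    ∃ v : FreeSphere N (Path (s : S) s), FreeSphere.map loopToGam v = w :=
  ⟨freeSphereLoop N ⟨w, h⟩, rfl⟩

end EndPoint

/-! ### Paths ending in the fiber, compared with loops in the base. -/

section Fibration

variable {S O : Type*} [TopologicalSpace S] [TopologicalSpace O] {f : C(S, O)}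
  (L : LiftingFunction f) {r : O}

/-- The projection of a path that starts at `s` and ends in the fiber of `s`. -/
def projLoop (f : C(S, O)) {r : O} (s : Fiber f r) : C(Gam (Fiber f r) s, Ω O r) where
  toFun α := ⟨f.comp α.1, (congrArg f α.2.1).trans s.2, α.2.2⟩
  continuous_toFun := continuous_induced_rng.2
    ((ContinuousMap.continuous_postcomp f).comp continuous_subtype_val)

/-- The lift of a loop to a path that starts at `s`. -/
def LiftingFunction.liftLoop (s : Fiber f r) : C(Ω O r, Gam (Fiber f r) s) where
  toFun ω := ⟨L.toMap (toDelta f r (ω, s)), L.start _, (L.lfFunction r (ω, s)).2⟩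
  continuous_toFun := Continuous.subtype_mk
    (L.toMap.continuous.comp ((toDelta f r).continuous.comp (by fun_prop))) _

theorem LiftingFunction.projLoop_comp_liftLoop (s : Fiber f r) :
    (projLoop f s).comp (L.liftLoop s) = .id _ :=
  ContinuousMap.ext fun ω => Path.ext (funext fun t =>
    DFunLike.congr_fun (L.lifts (toDelta f r (ω, s))) t)

theorem LiftingFunction.liftLoop_comp_projLoop (s : Fiber f r) :
    ((L.liftLoop s).comp (projLoop f s)).Homotopic (.id _) := by
  -- At stage u the path α is followed up to time u, and then the rest of its projection is lifted
  -- from α(u). Taking min(u, τ) as switching time covers both phases by one continuous formula.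
  let m : C((I × Gam (Fiber f r) s) × I, I) := ⟨fun q => min q.1.1 q.2, by fun_prop⟩
  let c : C((I × Gam (Fiber f r) s) × I, Delta f) :=
    ⟨fun q => ⟨(q.1.2.1 (m q), ⟨fun u => f (q.1.2.1
        (Set.projIcc 0 1 zero_le_one ((m q : ℝ) + u))), by
          have : Continuous fun u : I => Set.projIcc (0 : ℝ) 1 zero_le_one ((m q : ℝ) + u) :=
            continuous_projIcc.comp (by fun_prop)
          fun_prop⟩), by simp⟩, by
      refine Continuous.subtype_mk (Continuous.prodMk (by fun_prop) ?_) _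
      refine ContinuousMap.continuous_of_continuous_uncurry _ ?_
      have : Continuous fun q : ((I × Gam (Fiber f r) s) × I) × I =>
          Set.projIcc (0 : ℝ) 1 zero_le_one ((m q.1 : ℝ) + q.2) :=
        continuous_projIcc.comp (by fun_prop)
      change Continuous fun q : ((I × Gam (Fiber f r) s) × I) × I =>
        f (q.1.1.2.1 (Set.projIcc (0 : ℝ) 1 zero_le_one ((m q.1 : ℝ) + q.2)))
      fun_prop⟩
  let T : (I × Gam (Fiber f r) s) × I → S := fun q =>
    L.toMap (c q) (Set.projIcc 0 1 zero_le_one ((q.2 : ℝ) - m q))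
  have hT : Continuous T := by
    have : Continuous fun q : (I × Gam (Fiber f r) s) × I =>
        Set.projIcc (0 : ℝ) 1 zero_le_one ((q.2 : ℝ) - m q) :=
      continuous_projIcc.comp (by fun_prop)
    fun_prop
  have hfT : ∀ q τ, f (T (q, τ)) = f (q.2.1 τ) := by
    intro q τ
    have h₁ := DFunLike.congr_fun (L.lifts (c (q, τ)))
      (Set.projIcc 0 1 zero_le_one ((τ : ℝ) - m (q, τ)))
    refine h₁.trans ?_
    change f (q.2.1 (Set.projIcc 0 1 zero_le_one ((m (q, τ) : ℝ) +
      (Set.projIcc 0 1 zero_le_one ((τ : ℝ) - m (q, τ)) : I)))) = _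
    have hm : (m (q, τ) : ℝ) ≤ τ := Subtype.coe_le_coe.2 (min_le_right _ _)
    rw [Set.projIcc_of_mem zero_le_one (x := (τ : ℝ) - m (q, τ))
      ⟨by linarith, by linarith [τ.2.2, (m (q, τ)).2.1]⟩]
    simp
  have hT₀ : ∀ q, T (q, 0) = s := by
    intro q
    have hm : m (q, 0) = 0 := min_eq_right q.1.2.1
    simp only [T, hm, sub_self, Set.projIcc_left]
    refine (L.start _).trans ?_
    change q.2.1 (m (q, 0)) = s
    rw [hm]; exact q.2.2.1
  refine ⟨⟨⟨fun q => ⟨⟨fun τ => T (q, τ), by fun_prop⟩, hT₀ q, ?_⟩,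
    Continuous.subtype_mk (ContinuousMap.continuous_of_continuous_uncurry _ hT) _⟩, ?_, ?_⟩⟩
  · exact (hfT q 1).trans q.2.2.2
  · intro α
    refine Subtype.ext (ContinuousMap.ext fun τ => ?_)
    change T ((0, α), τ) = L.toMap (toDelta f r (projLoop f s α, s)) τ
    have hm : m ((0, α), τ) = 0 := min_eq_left τ.2.1
    have hc : c ((0, α), τ) = toDelta f r (projLoop f s α, s) := by
      refine Subtype.ext (Prod.ext ?_ (ContinuousMap.ext fun u => ?_))
      · change α.1 (m _) = _
        rw [hm]; exact α.2.1
      · change f (α.1 (Set.projIcc 0 1 zero_le_one ((m _ : ℝ) + u))) = f (α.1 u)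
        rw [hm]; simp
    simp only [T, hc, hm, Set.Icc.coe_zero, sub_zero, Set.projIcc_val]
  · intro α
    refine Subtype.ext (ContinuousMap.ext fun τ => ?_)
    change T ((1, α), τ) = α.1 τ
    have hm : m ((1, α), τ) = τ := min_eq_right τ.2.2
    simp only [T, hm, sub_self, Set.projIcc_left]
    refine (L.start _).trans ?_
    change α.1 (m _) = _
    rw [hm]

theorem LiftingFunction.lfRestriction_comp_projLoop (s : Fiber f r) :
    ((L.lfRestriction r s).comp (projLoop f s)).Homotopic (Psi (Fiber f r) s) :=
  ContinuousMap.Homotopic.comp (.refl (Psi (Fiber f r) s)) (L.liftLoop_comp_projLoop s)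

variable {Z : Type*} [TopologicalSpace Z] {s t : Fiber f r} (p : Path (s : S) t)
  {ω : C(Z, Ω O r)} {ψ : C(Z, Fiber f r)}
  (H : ((L.lfRestriction r t).comp ω).Homotopy ψ)

/-- A path from `s` to `t`, followed by the lift of a loop, followed by a path in the fiber. -/
noncomputable def LiftingFunction.extendPath (z : Z) : Path (s : S) (ψ z) :=
  p.trans (Path.trans (y := ((L.lfRestriction r t (ω z) : Fiber f r) : S))
    ⟨(L.liftLoop t (ω z)).1, (L.liftLoop t (ω z)).2.1, rfl⟩
    ((H.evalAt z).map continuous_subtype_val))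

/-- The map `z ↦ extendPath z`. -/
noncomputable def LiftingFunction.extend : C(Z, Gam (Fiber f r) s) where
  toFun z := ⟨(L.extendPath p H z).toContinuousMap, (L.extendPath p H z).source, by
    change L.extendPath p H z 1 ∈ _
    rw [Path.target]; exact (ψ z).2⟩
  continuous_toFun := by
    refine Continuous.subtype_mk (ContinuousMap.continuous_of_continuous_uncurry _ ?_) _
    refine Path.trans_continuous_family (fun _ : Z => p) (by
      change Continuous fun q : Z × I => p q.2; fun_prop) _
      (Path.trans_continuous_family (fun z : Z => (⟨(L.liftLoop t (ω z)).1,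
        (L.liftLoop t (ω z)).2.1, rfl⟩ : Path (t : S) (L.lfRestriction r t (ω z) : Fiber f r)))
        ?_ (fun z => (H.evalAt z).map continuous_subtype_val) ?_)
    · change Continuous fun q : Z × I => (L.liftLoop t (ω q.1)).1 q.2
      fun_prop
    · change Continuous fun q : Z × I => (H (q.2, q.1)).1
      fun_prop

theorem LiftingFunction.psi_comp_extend : (Psi (Fiber f r) s).comp (L.extend p H) = ψ :=
  ContinuousMap.ext fun z => Subtype.ext (L.extendPath p H z).target

theorem LiftingFunction.projLoop_extend (hp : ∀ τ, f (p τ) = r) (z : Z) :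
    projLoop f s (L.extend p H z) = (Path.refl r).trans ((ω z).trans (Path.refl r)) := by
  ext τ
  change f (L.extendPath p H z τ) = _
  simp only [extendPath, Path.trans_apply]
  split_ifs with h₁ h₂
  · exact hp _
  · exact DFunLike.congr_fun (L.lifts (toDelta f r (ω z, t))) _
  · exact (H _).2

/-- The two added pieces lie in the fiber, so the projection only acquires constant loops on either
side. -/
theorem LiftingFunction.projLoop_comp_extend (hp : ∀ τ, f (p τ) = r) :
    ((projLoop f s).comp (L.extend p H)).Homotopic ω := by
  have h : (projLoop f s).comp (L.extend p H) =
      (⟨fun p => (Path.refl r).trans p, by fun_prop⟩ : C(Ω O r, Ω O r)).comp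
        ((⟨fun p => p.trans (Path.refl r), by fun_prop⟩ : C(Ω O r, Ω O r)).comp ω) :=
    ContinuousMap.ext fun z => L.projLoop_extend p H hp z
  rw [h]
  exact (ContinuousMap.Homotopic.comp (homotopic_refl_trans r r)
    (ContinuousMap.Homotopic.comp (homotopic_trans_refl r r) (.refl ω))).symm

end Fibration

section Joined

variable {X : Type*} [TopologicalSpace X] {x y : X}

theorem joined_of_homotopic {p q : Path x y} (h : p.Homotopic q) : Joined p q := by
  obtain ⟨F⟩ := h
  exact ⟨⟨⟨fun t => F.eval t, Path.continuous_uncurry_iff.1 (by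
    change Continuous fun q : I × I => F q; fun_prop)⟩, F.eval_zero, F.eval_one⟩⟩

theorem joined_symm_trans (p : Path x y) (h : y = x) :
    Joined (((((Path.refl x).trans p).cast rfl h.symm).symm.trans p).cast rfl h.symm)
      (Path.refl x) := by
  subst h
  refine joined_of_homotopic (Homotopic.Quotient.eq.1 ?_)
  simp

end Joined

/-! ### Comparison of the two fibrations. -/

section Comparison

variable {S₁ S₂ O : Type*} [TopologicalSpace S₁] [TopologicalSpace S₂] [TopologicalSpace O]
  {f₁ : C(S₁, O)} {f₂ : C(S₂, O)} {r : O}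

/-- Two-out-of-three, as both projections to Ω(O, r) are homotopy equivalences. -/
theorem isHomotopyEquiv_of_projLoop (L₁ : LiftingFunction f₁) (L₂ : LiftingFunction f₂)
    {s₁ : Fiber f₁ r} {s₂ : Fiber f₂ r}
    {h : C(Gam (Fiber f₁ r) s₁, Gam (Fiber f₂ r) s₂)}
    (hh : ((projLoop f₂ s₂).comp h).Homotopic (projLoop f₁ s₁)) : IsHomotopyEquiv h := by
  refine ⟨(L₁.liftLoop s₁).comp (projLoop f₂ s₂), ?_, ?_⟩
  · exact (ContinuousMap.Homotopic.comp (.refl (L₁.liftLoop s₁)) hh).trans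
      (L₁.liftLoop_comp_projLoop s₁)
  · have h₁ : (h.comp ((L₁.liftLoop s₁).comp (projLoop f₂ s₂))).Homotopic
        (((L₂.liftLoop s₂).comp (projLoop f₂ s₂)).comp
          (h.comp ((L₁.liftLoop s₁).comp (projLoop f₂ s₂)))) :=
      (ContinuousMap.Homotopic.comp (L₂.liftLoop_comp_projLoop s₂)
        (.refl (h.comp ((L₁.liftLoop s₁).comp (projLoop f₂ s₂))))).symm
    have h₂ : (((L₂.liftLoop s₂).comp (projLoop f₂ s₂)).comp
          (h.comp ((L₁.liftLoop s₁).comp (projLoop f₂ s₂)))).Homotopic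
        ((L₂.liftLoop s₂).comp (((projLoop f₁ s₁).comp (L₁.liftLoop s₁)).comp
          (projLoop f₂ s₂))) :=
      ContinuousMap.Homotopic.comp (.refl (L₂.liftLoop s₂))
        (ContinuousMap.Homotopic.comp hh
          (.refl ((L₁.liftLoop s₁).comp (projLoop f₂ s₂))))
    rw [L₁.projLoop_comp_liftLoop] at h₂
    exact (h₁.trans h₂).trans (L₂.liftLoop_comp_projLoop s₂)

variable {L₁ : LiftingFunction f₁} {L₂ : LiftingFunction f₂}
  {g : Fiber f₁ r ≃ₕ Fiber f₂ r} {s : Fiber f₁ r}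

theorem ConjugateLfRestrictions.homotopic (hconj : ConjugateLfRestrictions L₁ L₂ r g s) :
    ((L₂.lfRestriction r (g s)).comp (projLoop f₁ s)).Homotopic
      (g.toFun.comp (Psi (Fiber f₁ r) s)) := by
  have h₁ : (g.toFun.comp (L₁.lfRestriction r s)).Homotopic (L₂.lfRestriction r (g s)) :=
    (ContinuousMap.Homotopic.comp (.refl g.toFun) hconj).trans
      (ContinuousMap.Homotopic.comp g.right_inv (.refl (L₂.lfRestriction r (g s))))
  exact (ContinuousMap.Homotopic.comp h₁.symm (.refl (projLoop f₁ s))).trans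
    (ContinuousMap.Homotopic.comp (.refl g.toFun) (L₁.lfRestriction_comp_projLoop s))

theorem ConjugateLfRestrictions.homotopic_symm
    (hconj : ConjugateLfRestrictions L₁ L₂ r g s) :
    ((L₁.lfRestriction r s).comp (projLoop f₂ (g s))).Homotopic
      (g.symm.toFun.comp (Psi (Fiber f₂ r) (g s))) :=
  (ContinuousMap.Homotopic.comp hconj (.refl (projLoop f₂ (g s)))).trans
    (ContinuousMap.Homotopic.comp (.refl g.symm.toFun)
      (L₂.lfRestriction_comp_projLoop (g s)))

theorem nonempty_mulEquiv_of_fiberMap (L₁ : LiftingFunction f₁) (L₂ : LiftingFunction f₂)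
    {h : C(Gam (Fiber f₁ r) s, Gam (Fiber f₂ r) (g s))}
    (hg : IsFiberMapOver (Psi (Fiber f₁ r) s) (Psi (Fiber f₂ r) (g s)) g.toFun h)
    (hh : ((projLoop f₂ (g s)).comp h).Homotopic (projLoop f₁ s))
    (φ : C(Path (s : S₁) s, Path (g s : S₂) (g s)))
    (hφ : ∀ p, loopToGam (φ p) = h (loopToGam p))
    (hc : Joined (φ (Path.refl _)) (Path.refl _)) (m : ℕ) :
    Nonempty (π_ (m + 2) S₁ (s : S₁) ≃* π_ (m + 2) S₂ (g s : S₂)) := by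
  have hq : ∀ e, FreeSphere.map (N := Fin (m + 1)) (Psi (Fiber f₂ r) (g s))
      (FreeSphere.map h e) = FreeSphere.map g.toFun (FreeSphere.map (Psi (Fiber f₁ r) s) e) :=
    fun e => FreeSphere.ext (DFunLike.congr_fun hg _) fun y => DFunLike.congr_fun hg _
  have hh' : IsHomotopyEquiv (FreeSphere.map (N := Fin (m + 1)) h) :=
    FreeSphere.isHomotopyEquiv_map (isHomotopyEquiv_of_projLoop L₁ L₂ hh)
  have hg' : IsHomotopyEquiv (FreeSphere.map (N := Fin (m + 1)) g.toFun) :=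
    FreeSphere.isHomotopyEquiv_map ⟨g.invFun, g.left_inv, g.right_inv⟩
  have hφ' : ∀ v : FreeSphere (Fin (m + 1)) (Path (s : S₁) s),
      FreeSphere.map (loopToGam (F := Fiber f₂ r) (s := g s)) (FreeSphere.map φ v) =
        FreeSphere.map h (FreeSphere.map loopToGam v) :=
    fun v => FreeSphere.ext (hφ _) fun y => hφ _
  obtain ⟨e⟩ := nonempty_mulEquiv_of_bijective (N := Fin (m + 1)) φ hc
    (fun v w hvw => joined_of_joinedIn_fiber_psi
      (joinedIn_fiber_of_map ((liftingFunctionPsi (Fiber f₁ r) s).freeSphere (Fin (m + 1)))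
        hq hh' hg' (map_psi_map_loopToGam v) (map_psi_map_loopToGam w) (by
          rw [← hφ', ← hφ']
          exact joinedIn_fiber_psi_of_joined hvw)))
    (fun w' => by
      obtain ⟨e, he, hj⟩ := exists_joinedIn_fiber_of_map
        ((liftingFunctionPsi (Fiber f₁ r) s).freeSphere (Fin (m + 1)))
        ((liftingFunctionPsi (Fiber f₂ r) (g s)).freeSphere (Fin (m + 1))) hq hh' hg'
        (b := FreeSphere.const s) (map_psi_map_loopToGam w')
      obtain ⟨v, rfl⟩ := exists_map_loopToGam he
      rw [← hφ'] at hj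
      exact ⟨v, joined_of_joinedIn_fiber_psi hj⟩)
  exact ⟨((homotopyGroupLoopEquiv m (s : S₁)).symm.trans e).trans
    (homotopyGroupLoopEquiv m (g s : S₂))⟩

theorem nonempty_mulEquiv_of_conjugate (hconj : ConjugateLfRestrictions L₁ L₂ r g s) (m : ℕ) :
    Nonempty (π_ (m + 2) S₁ (s : S₁) ≃* π_ (m + 2) S₂ (g s : S₂)) := by
  obtain ⟨H⟩ := hconj.homotopic
  let c : Gam (Fiber f₁ r) s := loopToGam (Path.refl (s : S₁))
  have hend : ∀ p : Path (s : S₁) s, g (Psi (Fiber f₁ r) s (loopToGam p)) = g s := fun p =>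
    congrArg g (Subtype.ext p.target)
  -- This is the loop to which the unmodified extension sends the constant path. Prefixing its
  -- reverse, which lies in the fiber, makes the image of the constant loop null-homotopic, as a map
  -- of based homotopy groups requires.
  let q : Path (g s : S₂) (g s) :=
    (L₂.extendPath (Path.refl (g s : S₂)) H c).cast rfl (congrArg Subtype.val (hend _).symm)
  have hq : ∀ τ, f₂ (q.symm τ) = r := by
    intro τ
    have h := L₂.projLoop_extend (Path.refl (g s : S₂)) H (fun _ => (g s).2) c
    have hc : projLoop f₁ s c = Path.refl r := Path.ext (funext fun _ => s.2)
    rw [hc, Path.refl_trans_refl, Path.refl_trans_refl] at h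
    exact congrArg (fun p : Ω O r => p (σ τ)) h
  let h := L₂.extend q.symm H
  have hψ := L₂.psi_comp_extend q.symm H
  let φ : C(Path (s : S₁) s, Path (g s : S₂) (g s)) :=
    { toFun := fun p => (L₂.extendPath q.symm H (loopToGam p)).cast rfl
        (congrArg Subtype.val (hend p).symm)
      continuous_toFun := continuous_induced_rng.2
        (continuous_subtype_val.comp (h.continuous.comp loopToGam.continuous)) }
  refine nonempty_mulEquiv_of_fiberMap L₁ L₂ (h := h) hψ (L₂.projLoop_comp_extend _ H hq) φ
    (fun p => rfl) ?_ m
  exact joined_symm_trans _ (congrArg Subtype.val (hend _))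

end Comparison

end LfFibration

theorem mainTheorem3 {S₁ S₂ O : Type*} [TopologicalSpace S₁] [TopologicalSpace S₂]
    [TopologicalSpace O] (f₁ : C(S₁, O)) (f₂ : C(S₂, O))
    (L₁ : LfFibration.LiftingFunction f₁) (L₂ : LfFibration.LiftingFunction f₂) (r₀ : O)
    (g : LfFibration.Fiber f₁ r₀ ≃ₕ LfFibration.Fiber f₂ r₀) (s₀ : LfFibration.Fiber f₁ r₀)
    (hconj : LfFibration.ConjugateLfRestrictions L₁ L₂ r₀ g s₀) :
    (∃ h : C(LfFibration.Gam (LfFibration.Fiber f₁ r₀) s₀,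
          LfFibration.Gam (LfFibration.Fiber f₂ r₀) (g s₀)),
        LfFibration.IsFiberMapOver (LfFibration.Psi (LfFibration.Fiber f₁ r₀) s₀)
          (LfFibration.Psi (LfFibration.Fiber f₂ r₀) (g s₀)) g.toFun h) ∧
    (∃ k : C(LfFibration.Gam (LfFibration.Fiber f₂ r₀) (g s₀),
          LfFibration.Gam (LfFibration.Fiber f₁ r₀) (g.symm (g s₀))),
        LfFibration.IsFiberMapOver (LfFibration.Psi (LfFibration.Fiber f₂ r₀) (g s₀))
          (LfFibration.Psi (LfFibration.Fiber f₁ r₀) (g.symm (g s₀))) g.symm.toFun k) ∧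
    (∀ m : ℕ, Nonempty ((π_ (m + 2) S₁ (s₀ : S₁)) ≃* (π_ (m + 2) S₂ (g s₀ : S₂)))) := by
  obtain ⟨H⟩ := hconj.homotopic
  obtain ⟨K⟩ := hconj.homotopic_symm
  obtain ⟨G⟩ := g.left_inv
  exact ⟨⟨L₂.extend (Path.refl _) H, L₂.psi_comp_extend _ H⟩,
    -- The conjugacy concerns lifts that start at s₀; the track of ḡ ∘ g ≃ id leads there from
    -- ḡ(g(s₀)).
    ⟨L₁.extend ((G.evalAt s₀).map continuous_subtype_val) K, L₁.psi_comp_extend _ K⟩,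
    LfFibration.nonempty_mulEquiv_of_conjugate hconj⟩
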